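/- **Lemma (Simulation Properties).** An $\omega$-automaton $\mathcal A$ over a finite alphabet $\Sigma$ has a finite state set $Q$, an initial state $q_0\in Q$, a transition relation $\Delta\subseteq Q\times\Sigma\times Q$, and an acceptance condition on the set of transitions that a run takes infinitely often (for instance Büchi: this set meets a given $\Gamma\subseteq Q\times\Sigma\times Q$; in general: it belongs to a given family of sets of transitions). The language $\mathcal L(\mathcal A)\subseteq\Sigma^\omega$ is the set of words that have an accepting run. *Simulation.* $\mathcal A$ simulates $\mathcal B$ if the duplicator has a winning strategy in the following game. The pebbles start on the initial states of $\mathcal B$ (spoiler) and $\mathcal A$ (duplicator). In each round the spoiler chooses a letter and a transition of $\mathcal B$ for that letter, and then the duplicator chooses a transition of $\mathcal A$ for the same letter; a player who cannot move loses. The duplicator wins an infinite play if his run of $\mathcal A$ is accepting or the spoiler's run of $\mathcal B$ is not accepting. *Good for games (GFG).* $\mathcal A$ is GFG if it simulates some deterministic $\omega$-automaton $\mathcal D$ with $\mathcal L(\mathcal D)=\mathcal L(\mathcal A)$. *Good for MDPs (GFM).* Let $\mathcal M$ be a finite MDP with transition function $T$, transitions $(s,a,s')$ labelled by letters $L(s,a,s')\in\Sigma$,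 and initial state $s_0$. The semantic satisfaction probability is the supremum, over all (history-dependent, randomized) strategies of $\mathcal M$, of the probability that the word of labels of the run is in $\mathcal L(\mathcal A)$. In the product $\mathcal M\times\mathcal A$, which starts in $(s_0,q_0)$, the strategy chooses in $(s,q)$ an action $a$ of $\mathcal M$ together with a successor state of $\mathcal A$ for each outcome $s'$ of $a$; then $(s',q')$, with $q'$ the successor chosen for $s'$, is reached with probability $T(s,a)(s')$ if $(q,L(s,a,s'),q')\in\Delta$, and the run is lost (not accepting) if this triple is not in $\Delta$. The syntactic satisfaction probability is the supremum, over all strategies of the product, of the probability that the $\mathcal A$-component of the run is an accepting run of $\mathcal A$. $\mathcal A$ is GFM if the two probabilities agree for every finite MDP and initial state. For all $\omega$-automata $\mathcal A$ and $\mathcal B$ over the same finite alphabet: 1. If $\mathcal A$ simulates $\mathcal B$, then $\mathcal L(\mathcal A)\supseteq\mathcal L(\mathcal B)$. 2. If $\mathcal A$ simulates $\mathcal B$ and $\mathcal L(\mathcal A)\subseteq\mathcal L(\mathcal B)$, then $\mathcal L(\mathcal A)=\mathcal L(\mathcal B)$. 3. If $\mathcal A$ simulates $\mathcal B$, $\mathcal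 L(\mathcal A)=\mathcal L(\mathcal B)$, and $\mathcal B$ is GFG, then $\mathcal A$ is GFG. 4. If $\mathcal A$ simulates $\mathcal B$, $\mathcal L(\mathcal A)=\mathcal L(\mathcal B)$, and $\mathcal B$ is GFM, then $\mathcal A$ is GFM. -/

import Mathlib

open MeasureTheory ProbabilityTheory
open scoped ENNReal

/-! ### Omega-automata, runs and languages -/

/-- A nondeterministic automaton on infinite words over the alphabet `α` with state set `Q`,
one initial state, a transition relation `trans`, and a transition-based acceptance condition.
The condition is given by the family `acc` of those sets of transitions that are accepted when
they are exactly the transitions taken infinitely often. For finite automata this covers the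
Büchi condition (see `OmegaAutomaton.buchi`) as well as the parity, Rabin, Streett and Muller
conditions. -/
structure OmegaAutomaton (α Q : Type*) where
  init : Q
  trans : Set (Q × α × Q)
  acc : Set (Set (Q × α × Q))

namespace OmegaAutomaton

variable {α Q Q' : Type*}

/-- The Büchi automaton `⟨α, Q, q₀, Δ, Γ⟩`: some transition in `Γ` has to be taken infinitely
often. -/
def buchi (q₀ : Q) (Δ Γ : Set (Q × α × Q)) : OmegaAutomaton α Q where
  init := q₀
  trans := Δ
  acc := {X | (X ∩ Γ).Nonempty}

/-- `r 0, w 0, r 1, w 1, …` is a run of `A` on the word `w`. -/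
def IsRun (A : OmegaAutomaton α Q) (w : ℕ → α) (r : ℕ → Q) : Prop :=
  r 0 = A.init ∧ ∀ n, (r n, w n, r (n + 1)) ∈ A.trans

/-- The set of transitions that occur infinitely often in `r 0, w 0, r 1, w 1, …`. -/
def infTrans (w : ℕ → α) (r : ℕ → Q) : Set (Q × α × Q) :=
  {t | ∃ᶠ n in Filter.atTop, (r n, w n, r (n + 1)) = t}

/-- `r 0, w 0, r 1, w 1, …` is an accepting run of `A` on the word `w`. -/
def IsAcceptingRun (A : OmegaAutomaton α Q) (w : ℕ → α) (r : ℕ → Q) : Prop :=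
  A.IsRun w r ∧ infTrans w r ∈ A.acc

/-- The language of `A`: the words that have an accepting run. -/
def language (A : OmegaAutomaton α Q) : Set (ℕ → α) :=
  {w | ∃ r, A.IsAcceptingRun w r}

/-- For each state and letter there is at most one successor. -/
def Deterministic (A : OmegaAutomaton α Q) : Prop :=
  ∀ q a q₁ q₂, (q, a, q₁) ∈ A.trans → (q, a, q₂) ∈ A.trans → q₁ = q₂

/-! ### The simulation game -/

/-- The moves (letter and new state) made in the first `n` rounds by a spoiler who produces
`r 0, w 0, r 1, w 1, …`. -/
def moves (w : ℕ → α) (r : ℕ → Q) (n : ℕ) : List (α × Q) :=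
  List.ofFn fun i : Fin n => (w i, r (i + 1))

/-- `A` simulates `B`: the duplicator, moving on `A`, has a winning strategy `σ` against the
spoiler, who moves on `B`. In each round the spoiler picks a letter and a transition of `B` for
this letter, and the duplicator answers with a transition of `A` for the same letter. The
strategy maps the moves the spoiler has made so far to the new position of the duplicator's
pebble. It starts in the initial state, it always answers a finite sequence of legal spoiler
moves with legal moves (a player who cannot move loses), and whenever the infinite run that the
spoiler produces is accepting, so is the run that the duplicator produces. -/
def Simulates (A : OmegaAutomaton α Q) (B : OmegaAutomaton α Q') : Prop :=
  ∃ σ : List (α × Q') → Q,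
    σ [] = A.init ∧
    (∀ (w : ℕ → α) (r : ℕ → Q') (n : ℕ), r 0 = B.init →
      (∀ i ≤ n, (r i, w i, r (i + 1)) ∈ B.trans) →
      (σ (moves w r n), w n, σ (moves w r (n + 1))) ∈ A.trans) ∧
    (∀ (w : ℕ → α) (r : ℕ → Q'), B.IsAcceptingRun w r →
      A.IsAcceptingRun w fun n => σ (moves w r n))

/-- `A` is good for games: it simulates a finite deterministic omega-automaton that recognizes
the same language. -/
def GoodForGames (A : OmegaAutomaton α Q) : Prop :=
  ∃ (P : Type) (_ : Finite P) (D : OmegaAutomaton α P),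
    D.Deterministic ∧ D.language = A.language ∧ A.Simulates D

end OmegaAutomaton

/-! ### Markov decision processes -/

/-- A Markov decision process with states `S`, actions `Act`, and transitions labelled by
letters of `α`. The actions available in `s` are `avail s`. -/
structure MDP (S Act α : Type*) where
  avail : S → Set Act
  avail_nonempty : ∀ s, (avail s).Nonempty
  T : S → Act → PMF S
  label : S → Act → S → α

namespace MDP

variable {S Act α Q : Type*}

/-- A strategy: a finite run `s₀, a₁, s₁, …, aₙ, sₙ`, given as the list
`(s₀, a₁), …, (sₙ₋₁, aₙ)` together with its last state `sₙ`, is mapped to a distribution over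
the actions available in `sₙ`. -/
structure Strategy (M : MDP S Act α) where
  choose : List (S × Act) → S → PMF Act
  support_subset : ∀ h s, (choose h s).support ⊆ M.avail s

/-- The word `L(s₀, a₁, s₁), L(s₁, a₂, s₂), …` of a run, where the run `s₀, a₁, s₁, a₂, …` is
given as the sequence `(s₀, a₁), (s₁, a₂), …`. -/
def word (M : MDP S Act α) (ρ : ℕ → S × Act) : ℕ → α :=
  fun n => M.label (ρ n).1 (ρ n).2 (ρ (n + 1)).1

/-- The distribution of `(sₙ₊₁, aₙ₊₂)` given the past `h = (s₀, a₁), …, (sₙ, aₙ₊₁)`, whose last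
entry is `p = (sₙ, aₙ₊₁)`. -/
noncomputable def next (M : MDP S Act α) (φ : M.Strategy) (h : List (S × Act)) (p : S × Act) :
    PMF (S × Act) :=
  (M.T p.1 p.2).bind fun s' => (φ.choose h s').map fun a' => (s', a')

/-- `MDP.next` as a Markov kernel from the first `n + 1` steps of a run to the next step. -/
noncomputable def stepKernel [Finite S] [Finite Act] [MeasurableSpace (S × Act)]
    [DiscreteMeasurableSpace (S × Act)] (M : MDP S Act α) (φ : M.Strategy) (n : ℕ) :
    Kernel (Π _ : Finset.Iic n, S × Act) (S × Act) :=
  Kernel.ofFunOfCountable fun x =>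
    (M.next φ (List.ofFn fun i : Fin (n + 1) => x ⟨i, Finset.mem_Iic.2 (Nat.lt_succ_iff.1 i.2)⟩)
      (x ⟨n, Finset.mem_Iic.2 le_rfl⟩)).toMeasure

instance [Finite S] [Finite Act] [MeasurableSpace (S × Act)] [DiscreteMeasurableSpace (S × Act)]
    (M : MDP S Act α) (φ : M.Strategy) (n : ℕ) : IsMarkovKernel (M.stepKernel φ n) :=
  ⟨fun _ => PMF.toMeasure.isProbabilityMeasure _⟩

/-- The law of the run of `M` from `s₀` under the strategy `φ`, on the product of the discrete
measurable spaces `S × Act`. -/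
noncomputable def runLaw [Finite S] [Finite Act] (M : MDP S Act α) (φ : M.Strategy) (s₀ : S) :
    @Measure (ℕ → S × Act) (@MeasurableSpace.pi ℕ (fun _ => S × Act) fun _ => ⊤) :=
  letI : MeasurableSpace (S × Act) := ⊤
  Kernel.trajMeasure (X := fun _ => S × Act)
    ((φ.choose [] s₀).map fun a => (s₀, a)).toMeasure (M.stepKernel φ)

/-- The probability that the run of `M` from `s₀` under `φ` lies in `E`. -/
noncomputable def prob [Finite S] [Finite Act] (M : MDP S Act α) (φ : M.Strategy) (s₀ : S)
    (E : Set (ℕ → S × Act)) : ℝ≥0∞ :=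
  M.runLaw φ s₀ E

/-! ### Satisfaction probabilities -/

/-- The semantic satisfaction probability: the supremum, over all strategies, of the probability
that the word of the run is in the language of `A`. -/
noncomputable def semSat [Finite S] [Finite Act] (M : MDP S Act α) (A : OmegaAutomaton α Q)
    (s₀ : S) : ℝ≥0∞ :=
  ⨆ φ : M.Strategy, M.prob φ s₀ {ρ | M.word ρ ∈ A.language}

open Classical in
/-- The state of `A` after an attempted move from `q` to `q'` with letter `a`, where `none`
means that no run of `A` is being built any more: an illegal move yields `none` forever. -/
noncomputable def autStep (A : OmegaAutomaton α Q) (q : Option Q) (a : α) (q' : Q) : Option Q :=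
  q.bind fun p => if (p, a, q') ∈ A.trans then some q' else none

/-- The product of `M` and `A`. An action is a pair of an action `a` of `M` and a rule `f`
saying to which state `f s'` the automaton moves when the outcome of `a` is `s'` and hence the
letter `L(s, a, s')` is read. From `(s, q)`, the state `(s', q')` with `q' = f s'` is reached
with probability `T(s, a)(s')` if `(q, L(s, a, s'), q')` is a transition of `A`; the mass of the
outcomes for which it is not one goes to the states `(s', none)`, from which nothing is
accepted. The labels of the product are those of `M`. -/
noncomputable def product (M : MDP S Act α) (A : OmegaAutomaton α Q) :
    MDP (S × Option Q) (Act × (S → Q)) α where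
  avail x := {b | b.1 ∈ M.avail x.1}
  avail_nonempty x := by
    obtain ⟨a, ha⟩ := M.avail_nonempty x.1
    exact ⟨(a, fun _ => A.init), ha⟩
  T x b := (M.T x.1 b.1).map fun s' => (s', autStep A x.2 (M.label x.1 b.1 s') (b.2 s'))
  label x b y := M.label x.1 b.1 y.1

/-- The runs of the product whose automaton component is an accepting run of `A` on the word
of the run. -/
def productAccepting (M : MDP S Act α) (A : OmegaAutomaton α Q) :
    Set (ℕ → (S × Option Q) × (Act × (S → Q))) :=
  {ρ | ∃ r : ℕ → Q, (∀ n, (ρ n).1.2 = some (r n)) ∧ A.IsAcceptingRun ((M.product A).word ρ) r}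

/-- The syntactic satisfaction probability: the supremum, over all strategies of the product,
of the probability that the run of the product is accepting. -/
noncomputable def synSat [Finite S] [Finite Act] [Finite Q] (M : MDP S Act α)
    (A : OmegaAutomaton α Q) (s₀ : S) : ℝ≥0∞ :=
  ⨆ φ : (M.product A).Strategy,
    (M.product A).prob φ (s₀, some A.init) (M.productAccepting A)

end MDP

/-- `A` is good for MDPs: for each finite MDP with an initial state, the syntactic and the
semantic satisfaction probabilities agree. -/
def OmegaAutomaton.GoodForMDPs {α Q : Type*} [Finite Q] (A : OmegaAutomaton α Q) : Prop :=
  ∀ (S Act : Type) [Finite S] [Finite Act] (M : MDP S Act α) (s₀ : S),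
    M.synSat A s₀ = M.semSat A s₀

/-! The duplicator's strategy turns an accepting run of B into an accepting run of A on the same
word, which gives the language inclusion and hence equality in the second claim. Winning strategies
compose (`Simulates.trans`), so a deterministic automaton simulated by B is simulated by A; this is
the GFG claim.

For GFM the chain is semSat A = semSat B = synSat B ≤ synSat A ≤ semSat A. Both inequalities
translate runs of one MDP into runs of another, online and compatibly with the transition
probabilities: for the last, the automaton component is forgotten; for the other, the duplicator's
strategy replaces the component of B by one of A. In both cases accepted runs go to accepted runs.

The analytic content is `exists_strategy_runLaw_eq_map`: the translated law is again the law of a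
strategy. Since different histories may have the same translation, the new strategy plays the
conditional law of the translated action given the translated history and state
(`PMF.exists_conditional`). The two laws then agree on finite histories, hence on infinite runs
(`ext_of_seqPrefix`). -/

/-! ### Disintegration of probability mass functions -/

namespace PMF

theorem bind_congr_of_support {α β : Type*} (p : PMF α) {f g : α → PMF β}
    (h : ∀ a ∈ p.support, f a = g a) : p.bind f = p.bind g := by
  ext b
  simp only [bind_apply]
  refine tsum_congr fun a => ?_
  by_cases ha : p a = 0
  · simp [ha]
  · rw [h a ((p.mem_support_iff a).2 ha)]

theorem map_apply_of_injective {α β : Type*} (p : PMF α) {f : α → β}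
    (hf : Function.Injective f) (a : α) : p.map f (f a) = p a := by
  classical
  rw [map_apply, tsum_eq_single a]
  · simp
  · intro b hb
    rw [if_neg fun h => hb (hf h).symm]

theorem map_apply_of_notMem_range {α β : Type*} (p : PMF α) {f : α → β} {b : β}
    (hb : ∀ a, f a ≠ b) : p.map f b = 0 := by
  classical
  rw [map_apply]
  simp [fun a => (hb a).symm]

theorem bind_map_prodMk_apply {α β : Type*} (p : PMF α) (k : α → PMF β) (a : α) (b : β) :
    (p.bind fun a => (k a).map (Prod.mk a)) (a, b) = p a * k a b := by
  rw [bind_apply, tsum_eq_single a]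
  · rw [map_apply_of_injective _ (Prod.mk_right_injective a)]
  · intro a' ha'
    rw [map_apply_of_notMem_range, mul_zero]
    rintro b' h
    exact ha' (congrArg Prod.fst h)

/-- The joint law of `f ω` and of a sample of `k ω` disintegrates over the law of `f ω`. -/
theorem exists_conditional {Ω Z β : Type*} (p : PMF Ω) (f : Ω → Z) (k : Ω → PMF β)
    (C : Z → Set β) (hC : ∀ z, (C z).Nonempty) (hk : ∀ ω, (k ω).support ⊆ C (f ω)) :
    ∃ k' : Z → PMF β, (∀ z, (k' z).support ⊆ C z) ∧
      ((p.map f).bind fun z => (k' z).map (Prod.mk z)) =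
        p.bind fun ω => (k ω).map (Prod.mk (f ω)) := by
  classical
  -- `k' z` averages `k` over `p` conditioned on the fibre over `z`. On a null fibre any point of `C
  -- z` serves, because both sides of the identity vanish there.
  refine ⟨fun z => if h : ∃ ω ∈ f ⁻¹' {z}, ω ∈ p.support then (p.filter _ h).bind k
    else pure (hC z).some, fun z => ?_, ?_⟩
  · dsimp only
    split_ifs with h
    · intro b hb
      obtain ⟨ω, hω, hb⟩ := (mem_support_bind_iff _ _ _).1 hb
      have := ((mem_support_filter_iff h).1 hω).1
      rw [← (this : f ω = z)]
      exact hk ω hb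
    · simp [(hC z).some_mem]
  · ext ⟨z, b⟩
    rw [bind_map_prodMk_apply, bind_apply]
    have hmap : p.map f z = ∑' ω, (f ⁻¹' {z}).indicator p ω := by
      rw [map_apply]
      refine tsum_congr fun ω => ?_
      simp [Set.indicator_apply, eq_comm]
    have hR : ∀ ω, p ω * (k ω).map (Prod.mk (f ω)) (z, b) =
        (f ⁻¹' {z}).indicator p ω * k ω b := by
      intro ω
      by_cases h : f ω = z
      · subst h
        rw [map_apply_of_injective _ (Prod.mk_right_injective _), Set.indicator_of_mem (by simp)]
      · rw [map_apply_of_notMem_range _ fun b' h' => h (congrArg Prod.fst h'),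
          Set.indicator_of_notMem (by simpa using h), mul_zero, zero_mul]
    rw [tsum_congr hR]
    split_ifs with h
    · have h0 : p.map f z ≠ 0 := by
        obtain ⟨ω, hω, hp⟩ := h
        exact (mem_support_iff _ _).1 ((mem_support_map_iff _ _ _).2 ⟨ω, hp, hω⟩)
      have ht : p.map f z ≠ ∞ := apply_ne_top _ _
      rw [bind_apply, ← ENNReal.tsum_mul_left]
      -- The normalizing constant of the conditioned law is the mass `p.map f z` of the fibre, so it
      -- cancels.
      refine tsum_congr fun ω => ?_
      rw [filter_apply, ← hmap, ← mul_assoc, mul_left_comm, ENNReal.mul_inv_cancel h0 ht, mul_one]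
    · have hz : ∀ ω, (f ⁻¹' {z}).indicator p ω = 0 := by
        intro ω
        by_contra hne
        have hmem : ω ∈ f ⁻¹' {z} := Set.mem_of_indicator_ne_zero hne
        rw [Set.indicator_of_mem hmem] at hne
        exact h ⟨ω, hmem, (mem_support_iff _ _).2 hne⟩
      simp [hmap, hz]

end PMF

/-! ### Finite prefixes of sequences -/

/-- The first `n` entries of a sequence. -/
def seqPrefix {E : Type*} (ρ : ℕ → E) (n : ℕ) : List E :=
  List.ofFn fun i : Fin n => ρ i

section seqPrefix

variable {E : Type*}

@[simp]
theorem seqPrefix_zero (ρ : ℕ → E) : seqPrefix ρ 0 = [] := rfl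

theorem seqPrefix_succ (ρ : ℕ → E) (n : ℕ) : seqPrefix ρ (n + 1) = seqPrefix ρ n ++ [ρ n] := by
  simp only [seqPrefix, List.ofFn_succ_last, Fin.val_castSucc, Fin.val_last]

@[simp]
theorem length_seqPrefix (ρ : ℕ → E) (n : ℕ) : (seqPrefix ρ n).length = n := by
  simp [seqPrefix]

theorem measurable_seqPrefix [Countable E] [MeasurableSpace E] [DiscreteMeasurableSpace E]
    [MeasurableSpace (List E)] (n : ℕ) :
    Measurable fun ρ : ℕ → E => seqPrefix ρ n := by
  have h : Measurable fun ρ : ℕ → E => fun i : Fin n => ρ i := by fun_prop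
  exact (Measurable.of_discrete (f := fun x : Fin n → E => List.ofFn x)).comp h

/-- A finite measure on sequences is determined by the laws of the finite prefixes. -/
theorem ext_of_seqPrefix [Countable E] [MeasurableSpace E] [DiscreteMeasurableSpace E]
    {μ ν : Measure (ℕ → E)} [IsFiniteMeasure μ] [IsFiniteMeasure ν]
    (h : ∀ n l, μ {ρ | seqPrefix ρ n = l} = ν {ρ | seqPrefix ρ n = l}) : μ = ν := by
  rcases isEmpty_or_nonempty E with hE | ⟨⟨e⟩⟩
  · exact Measure.ext fun s _ => by simp [Set.eq_empty_of_isEmpty s]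
  let _ : MeasurableSpace (List E) := ⊤
  have hmap : ∀ n, μ.map (fun ρ => seqPrefix ρ n) = ν.map fun ρ => seqPrefix ρ n := by
    intro n
    refine Measure.ext_of_singleton fun l => ?_
    rw [Measure.map_apply (measurable_seqPrefix n) (by trivial),
      Measure.map_apply (measurable_seqPrefix n) (by trivial)]
    exact h n l
  -- A measure on sequences is determined by its finite-dimensional marginals, and a finite index
  -- set lies below some `N`, so its marginal is an image of the prefix law. The filler `e` is never
  -- read.
  refine IsProjectiveLimit.unique (P := fun I : Finset ℕ => ν.map I.restrict) (fun I => ?_)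
    fun I => rfl
  obtain ⟨N, hN⟩ := I.exists_nat_subset_range
  have hI : (I.restrict : (ℕ → E) → _) =
      (fun l : List E => fun i : I => l[(i : ℕ)]?.getD e) ∘ fun ρ => seqPrefix ρ N := by
    funext ρ i
    have : (i : ℕ) < N := Finset.mem_range.1 (hN i.2)
    simp [seqPrefix, this]
  change μ.map I.restrict = ν.map I.restrict
  rw [hI, ← Measure.map_map Measurable.of_discrete (measurable_seqPrefix N),
    ← Measure.map_map Measurable.of_discrete (measurable_seqPrefix N), hmap]

end seqPrefix

namespace MDP

variable {S Act α : Type*}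

/-! ### The laws of finite histories -/

/-- The law of the state that follows the history `h` in a run from `s₀`. -/
noncomputable def stateDist (M : MDP S Act α) (s₀ : S) (h : List (S × Act)) : PMF S :=
  match h.getLast? with
  | none => PMF.pure s₀
  | some p => M.T p.1 p.2

/-- The law of the state and the action that follow the history `h` in a run from `s₀`. -/
noncomputable def stepDist (M : MDP S Act α) (φ : M.Strategy) (s₀ : S) (h : List (S × Act)) :
    PMF (S × Act) :=
  (M.stateDist s₀ h).bind fun s => (φ.choose h s).map fun a => (s, a)

/-- The law of the history of length `n` of a run from `s₀`. -/
noncomputable def histDist (M : MDP S Act α) (φ : M.Strategy) (s₀ : S) :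
    ℕ → PMF (List (S × Act))
  | 0 => PMF.pure []
  | n + 1 => (histDist M φ s₀ n).bind fun h => (M.stepDist φ s₀ h).map fun p => h ++ [p]

@[simp]
theorem stateDist_nil (M : MDP S Act α) (s₀ : S) : M.stateDist s₀ [] = PMF.pure s₀ := rfl

@[simp]
theorem stateDist_concat (M : MDP S Act α) (s₀ : S) (h : List (S × Act)) (p : S × Act) :
    M.stateDist s₀ (h ++ [p]) = M.T p.1 p.2 := by
  simp [stateDist]

theorem stepDist_nil (M : MDP S Act α) (φ : M.Strategy) (s₀ : S) :
    M.stepDist φ s₀ [] = (φ.choose [] s₀).map fun a => (s₀, a) := by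
  simp [stepDist]

theorem stepDist_concat (M : MDP S Act α) (φ : M.Strategy) (s₀ : S) (h : List (S × Act))
    (p : S × Act) : M.stepDist φ s₀ (h ++ [p]) = M.next φ (h ++ [p]) p := by
  simp [stepDist, next]

theorem length_of_mem_support_histDist (M : MDP S Act α) (φ : M.Strategy) (s₀ : S) {n : ℕ}
    {h : List (S × Act)} (hh : h ∈ (M.histDist φ s₀ n).support) : h.length = n := by
  induction n generalizing h with
  | zero => simp_all [histDist]
  | succ n ih =>
    rw [histDist, PMF.mem_support_bind_iff] at hh
    obtain ⟨h', hh', hh⟩ := hh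
    obtain ⟨p, -, rfl⟩ := (PMF.mem_support_map_iff _ _ _).1 hh
    simp [ih hh']

/-- Only the history `h` itself can be extended to `h ++ [p]`, so a single summand survives. -/
theorem histDist_succ_concat (M : MDP S Act α) (φ : M.Strategy) (s₀ : S) (n : ℕ)
    (h : List (S × Act)) (p : S × Act) :
    M.histDist φ s₀ (n + 1) (h ++ [p]) = M.histDist φ s₀ n h * M.stepDist φ s₀ h p := by
  rw [histDist, PMF.bind_apply, tsum_eq_single h]
  · rw [PMF.map_apply_of_injective _ (f := fun p => h ++ [p]) fun a b hab => by simpa using hab]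
  · intro h' hne
    rw [PMF.map_apply_of_notMem_range, mul_zero]
    intro q hq
    exact hne (List.append_inj_left' hq rfl)

theorem histDist_apply_eq_zero (M : MDP S Act α) (φ : M.Strategy) (s₀ : S) {n : ℕ}
    {h : List (S × Act)} (hh : h.length ≠ n) : M.histDist φ s₀ n h = 0 := by
  by_contra h0
  exact hh (M.length_of_mem_support_histDist φ s₀ ((PMF.mem_support_iff _ _).2 h0))

end MDP

/-- The law of the initial entry of a trajectory. -/
theorem ProbabilityTheory.Kernel.trajMeasure_map_eval_zero {E : Type*} [MeasurableSpace E]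
    (μ₀ : Measure E) [IsProbabilityMeasure μ₀]
    (κ : (n : ℕ) → Kernel (Π _ : Finset.Iic n, E) E) [∀ n, IsMarkovKernel (κ n)] :
    (Kernel.trajMeasure (X := fun _ => E) μ₀ κ).map (fun ρ => ρ 0) = μ₀ := by
  have h : (fun ρ : ℕ → E => ρ 0) =
      (fun x : (Π _ : Finset.Iic 0, E) => x ⟨0, by simp⟩) ∘ Preorder.frestrictLe 0 := rfl
  rw [h, ← Measure.map_map (by fun_prop) (by fun_prop), Kernel.trajMeasure,
    Measure.map_comp _ _ (by fun_prop), Kernel.traj_map_frestrictLe, Kernel.partialTraj_self,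
    Measure.id_comp, Measure.map_map (by fun_prop) (by fun_prop)]
  exact Measure.map_id

/-! ### Agreement of the run law with the laws of finite histories -/

namespace MDP

variable {S Act α : Type*} [Finite S] [Finite Act]

instance (M : MDP S Act α) (φ : M.Strategy) (s₀ : S) :
    @IsProbabilityMeasure _ (@MeasurableSpace.pi ℕ (fun _ => S × Act) fun _ => ⊤)
      (M.runLaw φ s₀) := by
  let _ : MeasurableSpace (S × Act) := ⊤
  have := PMF.toMeasure.isProbabilityMeasure ((φ.choose [] s₀).map fun a => (s₀, a))
  unfold runLaw
  infer_instance

/-- The probability of a finite history. -/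
theorem runLaw_seqPrefix (M : MDP S Act α) (φ : M.Strategy) (s₀ : S) (n : ℕ)
    (l : List (S × Act)) :
    M.runLaw φ s₀ {ρ | seqPrefix ρ n = l} = M.histDist φ s₀ n l := by
  let _ : MeasurableSpace (S × Act) := ⊤
  let _ : MeasurableSpace (List (S × Act)) := ⊤
  have := PMF.toMeasure.isProbabilityMeasure ((φ.choose [] s₀).map fun a => (s₀, a))
  have hprob : IsProbabilityMeasure (M.runLaw φ s₀) := inferInstance
  by_cases hl : l.length = n
  swap
  · rw [histDist_apply_eq_zero M φ s₀ hl]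
    convert measure_empty (μ := M.runLaw φ s₀)
    refine Set.eq_empty_of_forall_notMem fun ρ hρ => hl ?_
    rw [← (hρ : seqPrefix ρ n = l), length_seqPrefix]
  induction n generalizing l with
  | zero =>
    obtain rfl := List.length_eq_zero_iff.1 hl
    simp [histDist]
  | succ n ih =>
    obtain ⟨h, p, rfl⟩ : ∃ h p, l = h ++ [p] := by
      rcases List.eq_nil_or_concat l with rfl | ⟨h, p, rfl⟩
      · simp at hl
      · exact ⟨h, p, by simp⟩
    have hh : h.length = n := by simpa using hl
    rw [histDist_succ_concat, ← ih h hh]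
    have hset : {ρ : ℕ → S × Act | seqPrefix ρ (n + 1) = h ++ [p]} =
        {ρ | seqPrefix ρ n = h ∧ ρ n = p} := by
      ext ρ
      simp only [seqPrefix_succ, Set.mem_ofPred_eq]
      constructor
      · intro hρ
        have := List.append_inj' hρ rfl
        simpa using this
      · rintro ⟨rfl, rfl⟩; rfl
    rw [hset]
    -- The first entry is drawn from the initial law; kernels govern only the later ones, since
    -- `stepKernel φ n` reads `n + 1` entries.
    cases n with
    | zero =>
      obtain rfl := List.length_eq_zero_iff.1 hh
      have h0 := Kernel.trajMeasure_map_eval_zero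
        ((φ.choose [] s₀).map fun a => (s₀, a)).toMeasure (M.stepKernel φ)
      have h1 := congrArg (fun μ => μ {p}) h0
      rw [Measure.map_apply (by fun_prop) (by trivial),
        PMF.toMeasure_apply_singleton _ _ (by trivial)] at h1
      simp only [seqPrefix_zero, true_and, stepDist_nil, Set.ofPred_true, measure_univ, one_mul]
      exact h1
    | succ n =>
      have h0 := Kernel.map_frestrictLe_trajMeasure_compProd_eq_map_trajMeasure
        (X := fun _ => S × Act)
        (μ₀ := ((φ.choose [] s₀).map fun a => (s₀, a)).toMeasure) (κ := M.stepKernel φ) (a := n)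
      let L : (Π _ : Finset.Iic n, S × Act) → List (S × Act) := fun x =>
        List.ofFn fun i : Fin (n + 1) => x ⟨i, Finset.mem_Iic.2 (Nat.lt_succ_iff.1 i.2)⟩
      have h1 := congrArg (fun μ => μ ((L ⁻¹' {h}) ×ˢ {p})) h0
      rw [Measure.map_apply (by fun_prop) (MeasurableSet.of_discrete.prod (by trivial)),
        Measure.compProd_apply_prod MeasurableSet.of_discrete (by trivial)] at h1
      -- The kernel is constant on the cylinder of `h`, so the integral in the composition-product
      -- formula reduces to a product.
      have hker : ∀ x ∈ L ⁻¹' {h}, M.stepKernel φ n x {p} = M.stepDist φ s₀ h p := by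
        intro x hx
        have hx' : L x = h := hx
        have hlast : h = List.ofFn (fun i : Fin n =>
            x ⟨i, Finset.mem_Iic.2 i.2.le⟩) ++ [x ⟨n, Finset.mem_Iic.2 le_rfl⟩] := by
          rw [← hx']
          simp only [L, List.ofFn_succ_last, Fin.val_castSucc, Fin.val_last]
        have : M.stepDist φ s₀ h = M.next φ h (x ⟨n, Finset.mem_Iic.2 le_rfl⟩) := by
          rw [hlast, stepDist_concat]
        rw [this, ← hx']
        exact PMF.toMeasure_apply_singleton _ _ (by trivial)
      rw [setLIntegral_congr_fun MeasurableSet.of_discrete hker, setLIntegral_const,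
        Measure.map_apply (by fun_prop) MeasurableSet.of_discrete] at h1
      rw [mul_comm]
      exact h1.symm

end MDP

theorem OmegaAutomaton.moves_succ {α Q : Type*} (w : ℕ → α) (r : ℕ → Q) (n : ℕ) :
    OmegaAutomaton.moves w r (n + 1) = OmegaAutomaton.moves w r n ++ [(w n, r (n + 1))] := by
  simp only [OmegaAutomaton.moves, List.ofFn_succ_last, Fin.val_castSucc, Fin.val_last]

namespace MDP

/-! ### Simulating one decision process by another -/

section Transport

variable {S₁ Act₁ α₁ S₂ Act₂ α₂ : Type*}

/-- The image of a reversed history, when `F h x` and `G h x a` are the images of a state `x` and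
of an action `a` that follow the history `h`. -/
def mapHistoryRev (F : List (S₁ × Act₁) → S₁ → S₂) (G : List (S₁ × Act₁) → S₁ → Act₁ → Act₂) :
    List (S₁ × Act₁) → List (S₂ × Act₂)
  | [] => []
  | p :: t => mapHistoryRev F G t ++ [(F t.reverse p.1, G t.reverse p.1 p.2)]

/-- The image of a history, when `F h x` and `G h x a` are the images of a state `x` and of an
action `a` that follow the history `h`. -/
def mapHistory (F : List (S₁ × Act₁) → S₁ → S₂) (G : List (S₁ × Act₁) → S₁ → Act₁ → Act₂)
    (h : List (S₁ × Act₁)) : List (S₂ × Act₂) :=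
  mapHistoryRev F G h.reverse

/-- The image of an infinite run, when `F h x` and `G h x a` are the images of a state `x` and of
an action `a` that follow the history `h`. -/
def mapRun (F : List (S₁ × Act₁) → S₁ → S₂) (G : List (S₁ × Act₁) → S₁ → Act₁ → Act₂)
    (ρ : ℕ → S₁ × Act₁) : ℕ → S₂ × Act₂ :=
  fun n => (F (seqPrefix ρ n) (ρ n).1, G (seqPrefix ρ n) (ρ n).1 (ρ n).2)

variable (F : List (S₁ × Act₁) → S₁ → S₂) (G : List (S₁ × Act₁) → S₁ → Act₁ → Act₂)

@[simp]
theorem mapHistory_nil : mapHistory F G [] = [] := rfl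

-- The image of an entry depends on the entries before it, so the recursion must peel off the last
-- entry; this is why the definition passes through the reversed list.
@[simp]
theorem mapHistory_concat (h : List (S₁ × Act₁)) (p : S₁ × Act₁) :
    mapHistory F G (h ++ [p]) = mapHistory F G h ++ [(F h p.1, G h p.1 p.2)] := by
  simp [mapHistory, mapHistoryRev]

theorem seqPrefix_mapRun (ρ : ℕ → S₁ × Act₁) (n : ℕ) :
    seqPrefix (mapRun F G ρ) n = mapHistory F G (seqPrefix ρ n) := by
  induction n with
  | zero => simp
  | succ n ih => rw [seqPrefix_succ, seqPrefix_succ, mapHistory_concat, ih]; rfl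

variable {F G}

/-- If the states and actions of `N` are translated to `M`, along histories and consistently with
the transition probabilities, then the translation of the finite histories under a strategy of `N`
is governed by a strategy of `M`. -/
theorem exists_strategy_histDist_eq_map (N : MDP S₁ Act₁ α₁) (M : MDP S₂ Act₂ α₂)
    (φ : N.Strategy) (x₀ : S₁) (y₀ : S₂) (h_init : F [] x₀ = y₀)
    (h_avail : ∀ h x, ∀ a ∈ N.avail x, G h x a ∈ M.avail (F h x))
    (h_trans : ∀ h x a, (N.T x a).map (F (h ++ [(x, a)])) = M.T (F h x) (G h x a)) :
    ∃ ψ : M.Strategy, ∀ n,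
      M.histDist ψ y₀ n = (N.histDist φ x₀ n).map (mapHistory F G) := by
  -- The disintegration is applied to the law of the history of length `n` together with the next
  -- state, with the translation as the map and the translated choice of `φ` as the kernel.
  have key : ∀ n, ∃ k : List (S₂ × Act₂) × S₂ → PMF Act₂, (∀ z, (k z).support ⊆ M.avail z.2) ∧
      (((N.histDist φ x₀ n).bind fun h => (N.stateDist x₀ h).map (Prod.mk h)).map
          fun w => (mapHistory F G w.1, F w.1 w.2)).bind (fun z => (k z).map (Prod.mk z)) =
        ((N.histDist φ x₀ n).bind fun h => (N.stateDist x₀ h).map (Prod.mk h)).bind fun w =>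
          ((φ.choose w.1 w.2).map (G w.1 w.2)).map
            (Prod.mk (mapHistory F G w.1, F w.1 w.2)) := by
    intro n
    refine PMF.exists_conditional _ _ _
      (fun z : List (S₂ × Act₂) × S₂ => M.avail z.2) (fun z => M.avail_nonempty _) ?_
    rintro ⟨h, x⟩ b hb
    obtain ⟨a, ha, rfl⟩ := (PMF.mem_support_map_iff _ _ _).1 hb
    exact h_avail h x a (φ.support_subset h x ha)
  choose k hk hkeq using key
  have hstate : ∀ h, M.stateDist y₀ (mapHistory F G h) = (N.stateDist x₀ h).map (F h) := by
    intro h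
    rcases List.eq_nil_or_concat h with rfl | ⟨h, ⟨x, a⟩, rfl⟩
    · simp [PMF.pure_map, h_init]
    · simp [h_trans]
  -- A history determines its length, so the conditional laws for the different `n` combine into one
  -- strategy.
  let ψ : M.Strategy :=
    { choose := fun h y => k h.length (h, y)
      support_subset := fun h y => hk _ _ }
  refine ⟨ψ, fun n => ?_⟩
  induction n with
  | zero => simp [histDist, PMF.pure_map]
  | succ n ih =>
    have hlen : M.histDist ψ y₀ (n + 1) = (M.histDist ψ y₀ n).bind fun h =>
        (M.stateDist y₀ h).bind fun y => (k n (h, y)).map fun b => h ++ [(y, b)] := by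
      rw [histDist]
      refine PMF.bind_congr_of_support _ fun h hh => ?_
      simp only [stepDist, PMF.map_bind, PMF.map_comp, ψ,
        length_of_mem_support_histDist M ψ y₀ hh]
      rfl
    -- Appending the new state and action to the history turns the disintegration identity into the
    -- induction step.
    have happ := congrArg
      (PMF.map fun z : (List (S₂ × Act₂) × S₂) × Act₂ => z.1.1 ++ [(z.1.2, z.2)]) (hkeq n)
    rw [hlen, ih]
    simp only [PMF.map_bind, PMF.bind_map, PMF.bind_bind, PMF.map_comp, Function.comp_def]
      at happ
    simp only [histDist, stepDist, PMF.map_bind, PMF.bind_map, PMF.map_comp, hstate,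
      Function.comp_def, mapHistory_concat]
    exact happ

variable [Finite S₁] [Finite Act₁] [Finite S₂] [Finite Act₂]

/-- If the states and actions of `N` are translated to `M`, along histories and consistently with
the transition probabilities, then the translation of the runs under a strategy of `N` is governed
by a strategy of `M`. -/
theorem exists_strategy_runLaw_eq_map (N : MDP S₁ Act₁ α₁) (M : MDP S₂ Act₂ α₂)
    (φ : N.Strategy) (x₀ : S₁) (y₀ : S₂) (h_init : F [] x₀ = y₀)
    (h_avail : ∀ h x, ∀ a ∈ N.avail x, G h x a ∈ M.avail (F h x))
    (h_trans : ∀ h x a, (N.T x a).map (F (h ++ [(x, a)])) = M.T (F h x) (G h x a)) :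
    ∃ ψ : M.Strategy,
      ∀ (E₁ : Set (ℕ → S₁ × Act₁)) (E₂ : Set (ℕ → S₂ × Act₂)),
        (∀ ρ ∈ E₁, mapRun F G ρ ∈ E₂) → N.prob φ x₀ E₁ ≤ M.prob ψ y₀ E₂ := by
  obtain ⟨ψ, hψ⟩ := exists_strategy_histDist_eq_map N M φ x₀ y₀ h_init h_avail h_trans
  refine ⟨ψ, fun E₁ E₂ hE => ?_⟩
  let _ : MeasurableSpace (S₁ × Act₁) := ⊤
  let _ : MeasurableSpace (S₂ × Act₂) := ⊤
  let _ : MeasurableSpace (List (S₁ × Act₁)) := ⊤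
  have hmeas : Measurable (mapRun F G) := by
    refine measurable_pi_lambda _ fun n => ?_
    have h : (fun ρ => mapRun F G ρ n) =
        (fun q : List (S₁ × Act₁) × (S₁ × Act₁) => (F q.1 q.2.1, G q.1 q.2.1 q.2.2)) ∘
          fun ρ => (seqPrefix ρ n, ρ n) := rfl
    rw [h]
    exact Measurable.of_discrete.comp
      ((measurable_seqPrefix n).prodMk (measurable_pi_apply n))
  have hprob : IsProbabilityMeasure (N.runLaw φ x₀) := inferInstance
  have hprob' : IsProbabilityMeasure (M.runLaw ψ y₀) := inferInstance
  have hlaw : M.runLaw ψ y₀ = (N.runLaw φ x₀).map (mapRun F G) := by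
    refine ext_of_seqPrefix fun n l => ?_
    let _ : MeasurableSpace (List (S₂ × Act₂)) := ⊤
    have hms : MeasurableSet {ρ : ℕ → S₂ × Act₂ | seqPrefix ρ n = l} :=
      measurable_seqPrefix n (MeasurableSet.of_discrete (s := {l}))
    have hN : (N.histDist φ x₀ n).toMeasure =
        (N.runLaw φ x₀).map fun ρ => seqPrefix ρ n := by
      refine Measure.ext_of_singleton fun h => ?_
      rw [PMF.toMeasure_apply_singleton _ _ (by trivial),
        Measure.map_apply (measurable_seqPrefix n) (by trivial), ← runLaw_seqPrefix]
      rfl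
    rw [runLaw_seqPrefix, hψ, Measure.map_apply hmeas hms,
      ← PMF.toMeasure_apply_singleton _ l (by trivial),
      PMF.toMeasure_map_apply _ _ _ (by exact Measurable.of_discrete) (by trivial), hN,
      Measure.map_apply (measurable_seqPrefix n) (by trivial)]
    congr 1
    ext ρ
    simp [seqPrefix_mapRun]
  -- No measurability of the events is available; both inequalities hold for arbitrary sets.
  calc N.runLaw φ x₀ E₁ ≤ N.runLaw φ x₀ (mapRun F G ⁻¹' E₂) := measure_mono hE
    _ ≤ (N.runLaw φ x₀).map (mapRun F G) E₂ := Measure.le_map_apply hmeas.aemeasurable _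
    _ = M.runLaw ψ y₀ E₂ := by rw [hlaw]

end Transport

/-! ### Comparison of satisfaction probabilities -/

section Satisfaction

variable {S Act α Q Q' : Type*} [Finite S] [Finite Act]

/-- The syntactic satisfaction probability is at most the semantic one. -/
theorem synSat_le_semSat [Finite Q] (M : MDP S Act α) (A : OmegaAutomaton α Q) (s₀ : S) :
    M.synSat A s₀ ≤ M.semSat A s₀ := by
  refine iSup_le fun φ => ?_
  obtain ⟨ψ, hψ⟩ := exists_strategy_runLaw_eq_map (F := fun _ x => x.1) (G := fun _ _ b => b.1)
    (M.product A) M φ (s₀, some A.init) s₀ rfl (fun _ _ _ ha => ha) (fun h x b => by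
      change ((M.T x.1 b.1).map _).map _ = _
      rw [PMF.map_comp]
      exact PMF.map_id _)
  refine (hψ _ {ρ | M.word ρ ∈ A.language} ?_).trans
    (le_iSup (fun ψ => M.prob ψ s₀ {ρ | M.word ρ ∈ A.language}) ψ)
  rintro ρ ⟨r, -, hr⟩
  exact ⟨r, hr⟩

/-- The spoiler's moves in a reversed history of the product `M.product B` that ends in the
state `x`. -/
def spoilerMovesRev (M : MDP S Act α) (B : OmegaAutomaton α Q') :
    List ((S × Option Q') × (Act × (S → Q'))) → S × Option Q' → List (α × Q')
  | [], _ => []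
  | p :: t, x => spoilerMovesRev M B t p.1 ++
      [(M.label p.1.1 p.2.1 x.1, x.2.getD B.init)]

/-- The state of the duplicator's automaton `A` after a reversed history of the product
`M.product B` that ends in the state `x`, when the duplicator plays `σ`. -/
noncomputable def duplicatorStateRev (M : MDP S Act α) (A : OmegaAutomaton α Q)
    (B : OmegaAutomaton α Q') (σ : List (α × Q') → Q) :
    List ((S × Option Q') × (Act × (S → Q'))) → S × Option Q' → Option Q
  | [], _ => some A.init
  | p :: t, x => autStep A (duplicatorStateRev M A B σ t p.1) (M.label p.1.1 p.2.1 x.1)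
      (σ (spoilerMovesRev M B (p :: t) x))

/-- If `A` simulates `B`, then the syntactic satisfaction probability for `A` is at least the one
for `B`. -/
theorem synSat_le_synSat_of_simulates [Finite Q] [Finite Q'] (M : MDP S Act α)
    {A : OmegaAutomaton α Q} {B : OmegaAutomaton α Q'} (hAB : A.Simulates B) (s₀ : S) :
    M.synSat B s₀ ≤ M.synSat A s₀ := by
  obtain ⟨σ, hσ_init, hσ_legal, hσ_acc⟩ := hAB
  refine iSup_le fun φ => ?_
  -- The MDP state is kept and the state of B is replaced by the duplicator's. The latter is an
  -- `Option` because `σ` need not move legally once the spoiler's run is lost.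
  let F : List ((S × Option Q') × (Act × (S → Q'))) → S × Option Q' → S × Option Q :=
    fun h x => (x.1, duplicatorStateRev M A B σ h.reverse x)
  -- For each outcome `s'` the rule is the duplicator's answer to the move that the rule for B makes
  -- on `s'`. The default `B.init` enters only on lost runs, matching `spoilerMovesRev`.
  let G : List ((S × Option Q') × (Act × (S → Q'))) → S × Option Q' → Act × (S → Q') →
      Act × (S → Q) :=
    fun h x b => (b.1, fun s' => σ (spoilerMovesRev M B h.reverse x ++
      [(M.label x.1 b.1 s', (autStep B x.2 (M.label x.1 b.1 s') (b.2 s')).getD B.init)]))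
  obtain ⟨ψ, hψ⟩ := exists_strategy_runLaw_eq_map (F := F) (G := G)
    (M.product B) (M.product A) φ (s₀, some B.init) (s₀, some A.init) rfl
    (fun _ _ _ ha => ha) (fun h x b => by
      change ((M.T x.1 b.1).map _).map _ = (M.T x.1 b.1).map _
      rw [PMF.map_comp]
      congr 1
      funext s'
      simp [F, G, duplicatorStateRev, spoilerMovesRev])
  refine (hψ _ (M.productAccepting A) ?_).trans
    (le_iSup (fun ψ => (M.product A).prob ψ (s₀, some A.init) (M.productAccepting A)) ψ)
  rintro ρ ⟨r, hr, hacc⟩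
  set w := (M.product B).word ρ with hw
  -- On an accepting run the component of B is never `none`, so the recorded moves are the genuine
  -- ones.
  have hmoves : ∀ n, spoilerMovesRev M B (seqPrefix ρ n).reverse (ρ n).1 =
      OmegaAutomaton.moves w r n := by
    intro n
    induction n with
    | zero => rfl
    | succ n ih =>
      rw [OmegaAutomaton.moves_succ, ← ih, seqPrefix_succ, List.reverse_append]
      simp only [List.reverse_singleton, List.singleton_append, spoilerMovesRev, hr,
        Option.getD_some]
      rfl
  have hstate : ∀ n, duplicatorStateRev M A B σ (seqPrefix ρ n).reverse (ρ n).1 =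
      some (σ (OmegaAutomaton.moves w r n)) := by
    intro n
    induction n with
    | zero => exact congrArg some hσ_init.symm
    | succ n ih =>
      -- Legality of the answer keeps `autStep` from falling into `none`.
      have hlegal := hσ_legal w r n hacc.1.1 fun i _ => hacc.1.2 i
      rw [← hmoves (n + 1), seqPrefix_succ, List.reverse_append]
      simp only [List.reverse_singleton, List.singleton_append, duplicatorStateRev, ih]
      rw [← hmoves (n + 1), seqPrefix_succ, List.reverse_append] at hlegal
      exact if_pos hlegal
  exact ⟨fun n => σ (OmegaAutomaton.moves w r n), hstate, hσ_acc w r hacc⟩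

end Satisfaction

end MDP

/-! ### Properties of simulations -/

namespace OmegaAutomaton

variable {α Q Q' P : Type*}

theorem Simulates.language_subset {A : OmegaAutomaton α Q} {B : OmegaAutomaton α Q'}
    (h : A.Simulates B) : B.language ⊆ A.language := by
  obtain ⟨σ, -, -, hσ⟩ := h
  rintro w ⟨r, hr⟩
  exact ⟨_, hσ w r hr⟩

/-- The answers of the strategy `τ` to a reversed list of moves, as a list of moves. -/
def answersRev (τ : List (α × P) → Q') : List (α × P) → List (α × Q')
  | [] => []
  | p :: t => answersRev τ t ++ [(p.1, τ (p :: t).reverse)]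

theorem answersRev_reverse_moves (τ : List (α × P) → Q') (w : ℕ → α) (r : ℕ → P) (n : ℕ) :
    answersRev τ (moves w r n).reverse = moves w (fun i => τ (moves w r i)) n := by
  induction n with
  | zero => rfl
  | succ n ih =>
    rw [moves_succ w (fun i => τ (moves w r i)), ← ih]
    simp [moves_succ, answersRev]

/-- The strategy `σ` is played against the run of B that `τ` produces from the moves on D; each
answer needs only the moves made so far. -/
theorem Simulates.trans {A : OmegaAutomaton α Q} {B : OmegaAutomaton α Q'}
    {D : OmegaAutomaton α P} (hAB : A.Simulates B) (hBD : B.Simulates D) : A.Simulates D := by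
  obtain ⟨σ, hσ_init, hσ_legal, hσ_acc⟩ := hAB
  obtain ⟨τ, hτ_init, hτ_legal, hτ_acc⟩ := hBD
  refine ⟨fun l => σ (answersRev τ l.reverse), hσ_init, fun w r n hr hlegal => ?_,
    fun w r hacc => ?_⟩
  · simp only [answersRev_reverse_moves]
    exact hσ_legal w _ n hτ_init fun i hi =>
      hτ_legal w r i hr fun j hj => hlegal j (hj.trans hi)
  · simp only [answersRev_reverse_moves]
    exact hσ_acc w _ (hτ_acc w r hacc)

theorem Simulates.goodForGames {A : OmegaAutomaton α Q} {B : OmegaAutomaton α Q'}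
    (h : A.Simulates B) (hL : A.language = B.language) (hB : B.GoodForGames) :
    A.GoodForGames := by
  obtain ⟨P, hP, D, hD, hDB, hBD⟩ := hB
  exact ⟨P, hP, D, hD, hDB.trans hL.symm, h.trans hBD⟩

theorem Simulates.goodForMDPs [Finite Q] [Finite Q'] {A : OmegaAutomaton α Q}
    {B : OmegaAutomaton α Q'} (h : A.Simulates B) (hL : A.language = B.language)
    (hB : B.GoodForMDPs) : A.GoodForMDPs := by
  intro S Act _ _ M s₀
  refine (M.synSat_le_semSat A s₀).antisymm ?_
  calc M.semSat A s₀ = M.semSat B s₀ := by simp only [MDP.semSat, hL]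
    _ = M.synSat B s₀ := (hB S Act M s₀).symm
    _ ≤ M.synSat A s₀ := M.synSat_le_synSat_of_simulates h s₀

end OmegaAutomaton

theorem lemma1 {α QA QB : Type*} [Finite α] [Finite QA] [Finite QB]
    (A : OmegaAutomaton α QA) (B : OmegaAutomaton α QB) :
    (A.Simulates B → B.language ⊆ A.language) ∧
    (A.Simulates B → A.language ⊆ B.language → A.language = B.language) ∧
    (A.Simulates B → A.language = B.language → B.GoodForGames → A.GoodForGames) ∧
    (A.Simulates B → A.language = B.language → B.GoodForMDPs → A.GoodForMDPs) :=
  ⟨fun h => h.language_subset, fun h hL => hL.antisymm h.language_subset,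
    fun h hL hB => h.goodForGames hL hB, fun h hL hB => h.goodForMDPs hL hB⟩
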